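/- Let $G=(V,E)$ be a finite simple graph with $n=|V|\ge 3$ vertices, and let $|G\rangle=\prod_{\{u,v\}\in E}CZ(u,v)\,H^{\otimes V}|0\rangle^{\otimes V}\in(\mathbb C^2)^{\otimes n}$ be its graph state, $\rho=|G\rangle\langle G|$. For $J\subseteq V$ let $\rho_J=\mathrm{Tr}_{V\setminus J}\,\rho$, let $S_2(J)=1-\mathrm{Tr}(\rho_J^2)$ be the linear entropy, and let $C_2(J)=\sum_{j\in J}S_2(\{j\})-S_2(J)$ be the 2-deformed total correlation. For real $\varepsilon\ge 0$ let $X(\varepsilon)$ be the simplicial complex on $V$ whose faces are the nonempty $J\subseteq V$ with $C_2(J)\le\varepsilon$, and let $\beta_k(\varepsilon)$ (the number of $k$-dimensional holes) be the dimension of the (unreduced) homology group $H_k(X(\varepsilon);\mathbb F_2)$; in particular $\beta_0(\varepsilon)$ is the number of connected components. Then the following three statements are equivalent: 1. $\beta_0(\varepsilon)=n$ for all $0\le\varepsilon<\tfrac12$, and $\beta_0(\tfrac12)=1$ and $\beta_1(\tfrac12)=\frac{(n-1)(n-2)}{2}$; 2. $G$ is a star (for some vertex $c$, the edges of $G$ are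 exactly the pairs $\{c,v\}$ with $v\ne c$) or $G$ is a complete graph; 3. $|G\rangle$ is locally unitarily equivalent to the GHZ state, i.e. there are unitaries $U_v\in U(2)$, $v\in V$, with $\bigl(\bigotimes_{v\in V}U_v\bigr)|G\rangle=\frac{1}{\sqrt2}\bigl(|0\rangle^{\otimes n}+|1\rangle^{\otimes n}\bigr)$. -/

import Mathlib

set_option maxSynthPendingDepth 3

open scoped Matrix

noncomputable section

namespace QubitTDA

/-! ## Qubit systems

The qubits are labelled by a finite type `V`; the Hilbert space `(ℂ²)^{⊗V}` has the computational
basis `V → Fin 2`. -/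

section States

set_option linter.unusedSectionVars false

variable {V : Type*} [Fintype V] [DecidableEq V]

/-- A pure state: a unit vector of `(ℂ²)^{⊗V}`, given by its amplitudes in the computational
basis. -/
structure PureState (V : Type*) [Fintype V] [DecidableEq V] where
  amp : (V → Fin 2) → ℂ
  normalized : ∑ x, ‖amp x‖ ^ 2 = 1

/-- The density matrix `ρ = |ψ⟩⟨ψ|`. -/
def PureState.density (ψ : PureState V) : Matrix (V → Fin 2) (V → Fin 2) ℂ :=
  Matrix.vecMulVec ψ.amp (star ψ.amp)

/-- The partial trace over the qubits outside `J`: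
`(Tr_{Jᶜ} ρ)(x, y) = ∑_z ρ((x, z), (y, z))`, with `z` running over the basis of `Jᶜ`. -/
def partialTrace (J : Finset V) (ρ : Matrix (V → Fin 2) (V → Fin 2) ℂ) :
    Matrix ({v // v ∈ J} → Fin 2) ({v // v ∈ J} → Fin 2) ℂ :=
  Matrix.of fun x y => ∑ z : {v // v ∉ J} → Fin 2,
    ρ ((Equiv.piEquivPiSubtypeProd (· ∈ J) (fun _ => Fin 2)).symm (x, z))
      ((Equiv.piEquivPiSubtypeProd (· ∈ J) (fun _ => Fin 2)).symm (y, z))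

/-- The reduced state `ρ_J`. -/
def PureState.reduced (ψ : PureState V) (J : Finset V) :
    Matrix ({v // v ∈ J} → Fin 2) ({v // v ∈ J} → Fin 2) ℂ :=
  partialTrace J ψ.density

/-- The linear entropy (Tsallis entropy for `q = 2`): `S₂(J) = 1 - Tr ρ_J²`. -/
def PureState.linearEntropy (ψ : PureState V) (J : Finset V) : ℝ :=
  1 - (Matrix.trace (ψ.reduced J ^ 2)).re

/-- The 2-deformed total correlation of the qubits in `J`:
`C₂(J) = ∑_{j ∈ J} S₂({j}) - S₂(J)`. -/
def PureState.totalCorrelation (ψ : PureState V) (J : Finset V) : ℝ :=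
  ∑ j ∈ J, ψ.linearEntropy {j} - ψ.linearEntropy J

/-- The tensor product `⨂_v U_v` of one-qubit operators. -/
def tensorOp (U : V → Matrix (Fin 2) (Fin 2) ℂ) : Matrix (V → Fin 2) (V → Fin 2) ℂ :=
  Matrix.of fun x y => ∏ v, U v (x v) (y v)

/-- `φ = (⨂_v U_v) ψ` for some one-qubit unitaries `U_v`. -/
def LUEquivalent (ψ φ : (V → Fin 2) → ℂ) : Prop :=
  ∃ U : V → Matrix.unitaryGroup (Fin 2) ℂ,
    φ = tensorOp (fun v => (U v : Matrix (Fin 2) (Fin 2) ℂ)) *ᵥ ψ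

/-- The vector `|GHZ⟩ = (|0…0⟩ + |1…1⟩)/√2`. -/
def ghz (V : Type*) [Fintype V] [DecidableEq V] : (V → Fin 2) → ℂ :=
  ((1 / Real.sqrt 2 : ℝ) : ℂ) • (Pi.single (fun _ => 0) 1 + Pi.single (fun _ => 1) 1)

/-! ### Graph states -/

/-- The Hadamard gate. -/
def hadamard : Matrix (Fin 2) (Fin 2) ℂ :=
  ((1 / Real.sqrt 2 : ℝ) : ℂ) • !![1, 1; 1, -1]

/-- The sign with which the controlled-`Z` gate on the pair `e` acts on the basis vector `|x⟩`. -/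
def czSign (e : Sym2 V) (x : V → Fin 2) : ℂ :=
  open Classical in if ∀ v ∈ e, x v = 1 then -1 else 1

/-- The controlled-`Z` gate between the two qubits of the (unordered) pair `e`. -/
def czGate (e : Sym2 V) : Matrix (V → Fin 2) (V → Fin 2) ℂ :=
  Matrix.diagonal (czSign e)

theorem czGate_commute (e f : Sym2 V) : Commute (czGate e) (czGate f) := by
  simp only [czGate, Commute, SemiconjBy, Matrix.diagonal_mul_diagonal, mul_comm]

/-- `∏_{e ∈ E} CZ(e) · H^{⊗V} |0⟩^{⊗V}`. -/
def graphVector (G : SimpleGraph V) [DecidableRel G.Adj] : (V → Fin 2) → ℂ :=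
  (G.edgeFinset.noncommProd czGate fun e _ f _ _ => czGate_commute e f) *ᵥ
    (tensorOp (fun _ => hadamard) *ᵥ Pi.single (fun _ => 0) 1)

theorem graphVector_apply (G : SimpleGraph V) [DecidableRel G.Adj] (x : V → Fin 2) :
    graphVector G x =
      (∏ e ∈ G.edgeFinset, czSign e x) * ((1 / Real.sqrt 2 : ℝ) : ℂ) ^ Fintype.card V := by
  have h : (G.edgeFinset.noncommProd czGate fun e _ f _ _ => czGate_commute e f) =
      Matrix.diagonal (∏ e ∈ G.edgeFinset, czSign e) := by
    have := Finset.map_noncommProd G.edgeFinset (fun e : Sym2 V => czSign e)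
      (fun e _ f _ _ => Commute.all _ _) (Matrix.diagonalRingHom (V → Fin 2) ℂ)
    rw [Finset.noncommProd_eq_prod] at this
    exact this.symm
  have h2 : ∀ i : Fin 2, hadamard i 0 = ((1 / Real.sqrt 2 : ℝ) : ℂ) := by
    intro i; fin_cases i <;> simp [hadamard]
  rw [graphVector, h, Matrix.mulVec_diagonal, Matrix.mulVec_single_one, Finset.prod_apply]
  congr 1
  simp only [Matrix.col_apply, tensorOp, Matrix.of_apply, h2, Finset.prod_const, Finset.card_univ]

/-- The graph state `|G⟩`. -/
def graphState (G : SimpleGraph V) [DecidableRel G.Adj] : PureState V where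
  amp := graphVector G
  normalized := by
    have h : ∀ (e : Sym2 V) (x : V → Fin 2), ‖czSign e x‖ = 1 := by
      intro e x; unfold czSign; split <;> simp
    have h2 : ‖((1 / Real.sqrt 2 : ℝ) : ℂ)‖ ^ 2 = 1 / 2 := by
      rw [Complex.norm_real, Real.norm_eq_abs, sq_abs, div_pow, Real.sq_sqrt (by norm_num)]
      norm_num
    simp only [graphVector_apply, norm_mul, norm_prod, h, Finset.prod_const_one, one_mul,
      norm_pow, ← pow_mul, mul_comm _ 2]
    simp only [pow_mul, h2]
    simp

/-! ### Downward closure of the total correlation -/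

/-- Exchange the qubits in `J` between two copies of the system. -/
def swapOn (J : Finset V) (p : (V → Fin 2) × (V → Fin 2)) : (V → Fin 2) × (V → Fin 2) :=
  (fun v => if v ∈ J then p.2 v else p.1 v, fun v => if v ∈ J then p.1 v else p.2 v)

theorem swapOn_swapOn (J K : Finset V) (p : (V → Fin 2) × (V → Fin 2)) :
    swapOn J (swapOn K p) = swapOn (symmDiff J K) p := by
  ext v <;> by_cases h1 : v ∈ J <;> by_cases h2 : v ∈ K <;>
    simp [swapOn, h1, h2, Finset.mem_symmDiff]

theorem swapOn_empty (p : (V → Fin 2) × (V → Fin 2)) : swapOn ∅ p = p := by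
  simp [swapOn]

theorem swapOn_involutive (J : Finset V) : Function.Involutive (swapOn J) := fun p => by
  rw [swapOn_swapOn, symmDiff_self, Finset.bot_eq_empty, swapOn_empty]

/-- The amplitude of `ψ ⊗ ψ`. -/
def PureState.pair (ψ : PureState V) (p : (V → Fin 2) × (V → Fin 2)) : ℂ :=
  ψ.amp p.1 * ψ.amp p.2

/-- `⟨ψψ| F_J |ψψ⟩` for the swap `F_J`. -/
def PureState.swapSum (ψ : PureState V) (J : Finset V) : ℂ :=
  ∑ p, ψ.pair p * star (ψ.pair (swapOn J p))

theorem PureState.trace_reduced_sq (ψ : PureState V) (J : Finset V) :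
    Matrix.trace (ψ.reduced J ^ 2) = ψ.swapSum J := by
  let E := Equiv.piEquivPiSubtypeProd (· ∈ J) (fun _ : V => Fin 2)
  have hsw : ∀ x y z w, swapOn J (E.symm (x, z), E.symm (y, w)) =
      (E.symm (y, z), E.symm (x, w)) := by
    intro x y z w
    ext v <;> by_cases h : v ∈ J <;> simp [swapOn, E, Equiv.piEquivPiSubtypeProd, h]
  have h1 : ψ.swapSum J = ∑ q : ((({v // v ∈ J} → Fin 2) × ({v // v ∉ J} → Fin 2)) ×
      (({v // v ∈ J} → Fin 2) × ({v // v ∉ J} → Fin 2))),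
      ψ.amp (E.symm q.1) * ψ.amp (E.symm q.2) *
        star (ψ.amp (E.symm (q.2.1, q.1.2)) * ψ.amp (E.symm (q.1.1, q.2.2))) := by
    rw [PureState.swapSum, ← (Equiv.prodCongr E.symm E.symm).sum_comp]
    refine Finset.sum_congr rfl fun q _ => ?_
    obtain ⟨⟨x, z⟩, ⟨y, w⟩⟩ := q
    simp only [Equiv.prodCongr_apply, Prod.map, hsw, PureState.pair]
  rw [h1]
  simp only [Fintype.sum_prod_type, pow_two, Matrix.trace, Matrix.diag, Matrix.mul_apply,
    PureState.reduced, partialTrace, PureState.density, Matrix.of_apply, Matrix.vecMulVec_apply,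
    Pi.star_apply, Finset.sum_mul_sum, star_mul']
  refine Finset.sum_congr rfl fun x _ => ?_
  rw [Finset.sum_comm]
  refine Finset.sum_congr rfl fun z _ => ?_
  refine Finset.sum_congr rfl fun y _ => ?_
  refine Finset.sum_congr rfl fun w _ => ?_
  simp only [E]
  ring

theorem PureState.sum_pair_swap (ψ : PureState V) (J K : Finset V) :
    ∑ p, ψ.pair (swapOn J p) * star (ψ.pair (swapOn K p)) = ψ.swapSum (symmDiff K J) := by
  rw [← Equiv.sum_comp (swapOn_involutive J).toPerm]
  simp only [Function.Involutive.coe_toPerm, swapOn_involutive J _, swapOn_swapOn]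
  rfl

theorem PureState.swapSum_empty (ψ : PureState V) : ψ.swapSum ∅ = 1 := by
  have h : ∀ p, ψ.pair p * star (ψ.pair (swapOn ∅ p)) =
      ((‖ψ.amp p.1‖ ^ 2 * ‖ψ.amp p.2‖ ^ 2 : ℝ) : ℂ) := by
    intro p
    rw [swapOn_empty, PureState.pair]
    push_cast
    rw [← Complex.mul_conj', ← Complex.mul_conj']
    simp only [star_mul', Complex.star_def]
    ring
  rw [PureState.swapSum, Finset.sum_congr rfl fun p _ => h p, ← Complex.ofReal_sum,
    Fintype.sum_prod_type]
  simp only [← Finset.mul_sum, ← Finset.sum_mul, ψ.normalized]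
  simp

/-- Subadditivity of the linear entropy. -/
theorem PureState.linearEntropy_union_le (ψ : PureState V) {A B : Finset V}
    (h : Disjoint A B) :
    ψ.linearEntropy (A ∪ B) ≤ ψ.linearEntropy A + ψ.linearEntropy B := by
  have hAB : symmDiff A B = A ∪ B := by
    rw [Disjoint.symmDiff_eq_sup h]; rfl
  have hBA : symmDiff B A = A ∪ B := by rw [symmDiff_comm, hAB]
  have h1 : symmDiff A (A ∪ B) = B := by rw [← hAB, symmDiff_symmDiff_cancel_left]
  have h2 : symmDiff B (A ∪ B) = A := by rw [← hBA, symmDiff_symmDiff_cancel_left]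
  have h3 : symmDiff (A ∪ B) A = B := by rw [symmDiff_comm, h1]
  have h4 : symmDiff (A ∪ B) B = A := by rw [symmDiff_comm, h2]
  have e1 : ∀ X : Finset V, symmDiff X ∅ = X := fun X => symmDiff_bot X
  have e2 : ∀ X : Finset V, symmDiff ∅ X = X := fun X => bot_symmDiff X
  have e3 : ∀ X : Finset V, symmDiff X X = ∅ := fun X => symmDiff_self X
  let g : (V → Fin 2) × (V → Fin 2) → ℂ := fun p =>
    ψ.pair (swapOn ∅ p) - ψ.pair (swapOn A p) - ψ.pair (swapOn B p) + ψ.pair (swapOn (A ∪ B) p)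
  have hg : ∑ p, g p * star (g p) =
      4 * (1 - ψ.swapSum A - ψ.swapSum B + ψ.swapSum (A ∪ B)) := by
    simp only [g, star_add, star_sub, add_mul, sub_mul, mul_add, mul_sub,
      Finset.sum_add_distrib, Finset.sum_sub_distrib, ψ.sum_pair_swap,
      hAB, hBA, h1, h2, h3, h4, e1, e2, e3, ψ.swapSum_empty]
    ring
  have hpos : 0 ≤ (∑ p, g p * star (g p)).re := by
    rw [Complex.re_sum]
    refine Finset.sum_nonneg fun p _ => ?_
    rw [Complex.star_def, Complex.mul_conj, Complex.ofReal_re]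
    exact Complex.normSq_nonneg _
  rw [hg] at hpos
  simp only [PureState.linearEntropy, PureState.trace_reduced_sq]
  have : (4 * (1 - ψ.swapSum A - ψ.swapSum B + ψ.swapSum (A ∪ B))).re =
      4 * (1 - (ψ.swapSum A).re - (ψ.swapSum B).re + (ψ.swapSum (A ∪ B)).re) := by
    simp
  rw [this] at hpos
  linarith

/-- Downward closure: `J ⊆ K` implies `C₂(J) ≤ C₂(K)`. -/
theorem PureState.totalCorrelation_mono (ψ : PureState V) : Monotone ψ.totalCorrelation := by
  rw [Finset.monotone_iff_forall_le_cons]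
  intro J v hv
  have h := ψ.linearEntropy_union_le (A := {v}) (B := J) (by simpa using hv)
  rw [← Finset.insert_eq] at h
  simp only [PureState.totalCorrelation, Finset.cons_eq_insert, Finset.sum_insert hv]
  linarith

/-- The entanglement complex `X(ψ, ε)`: the faces are the nonempty sets of qubits `J` with
`C₂(J) ≤ ε`. For `ε ≥ 0` every vertex is a face, since `C₂({j}) = 0`. -/
def PureState.complex (ψ : PureState V) (ε : ℝ) : PreAbstractSimplicialComplex V where
  faces := {J | J.Nonempty ∧ ψ.totalCorrelation J ≤ ε}
  isRelLowerSet_faces := fun _ h =>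
    ⟨h.1, fun _ hle hne => ⟨hne, (ψ.totalCorrelation_mono hle).trans h.2⟩⟩

end States

/-! ## Simplicial homology over `𝔽₂` -/

section Homology

variable {V : Type*} [DecidableEq V]

/-- The `k`-dimensional faces: those with `k + 1` vertices. -/
abbrev Face (X : PreAbstractSimplicialComplex V) (k : ℕ) : Type _ :=
  {s : Finset V // s ∈ X.faces ∧ s.card = k + 1}

/-- The `k`-chains over `𝔽₂`. -/
abbrev Chain (X : PreAbstractSimplicialComplex V) (k : ℕ) : Type _ :=
  Face X k →₀ ZMod 2

/-- The facet of a `(k+1)`-face obtained by removing one vertex. -/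
def Face.erase {X : PreAbstractSimplicialComplex V} {k : ℕ} (s : Face X (k + 1))
    (v : {v // v ∈ s.1}) : Face X k :=
  ⟨s.1.erase v.1, by
    have hc : (s.1.erase v.1).card = k + 1 := by
      rw [Finset.card_erase_of_mem v.2, s.2.2]; rfl
    exact ⟨(X.isRelLowerSet_faces s.2.1).2 (Finset.erase_subset _ _)
      (Finset.card_pos.1 (by omega)), hc⟩⟩

/-- The boundary map `∂_{k+1}` from `(k+1)`-chains to `k`-chains: a face is sent to the sum of
its facets. -/
def boundary (X : PreAbstractSimplicialComplex V) (k : ℕ) :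
    Chain X (k + 1) →ₗ[ZMod 2] Chain X k :=
  Finsupp.linearCombination (ZMod 2) fun s => ∑ v, Finsupp.single (s.erase v) 1

/-- The `k`-cycles `ker ∂_k`, where `∂_0 = 0`. -/
def cycles (X : PreAbstractSimplicialComplex V) : (k : ℕ) → Submodule (ZMod 2) (Chain X k)
  | 0 => ⊤
  | k + 1 => LinearMap.ker (boundary X k)

/-- The `k`-boundaries `im ∂_{k+1}`. -/
def boundaries (X : PreAbstractSimplicialComplex V) (k : ℕ) : Submodule (ZMod 2) (Chain X k) :=
  LinearMap.range (boundary X k)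

/-- The homology group `H_k = ker ∂_k / im ∂_{k+1}`. -/
abbrev Homology (X : PreAbstractSimplicialComplex V) (k : ℕ) : Type _ :=
  cycles X k ⧸ (boundaries X k).submoduleOf (cycles X k)

/-- The number of `k`-dimensional holes: the Betti number `β_k = dim H_k`. -/
def betti (X : PreAbstractSimplicialComplex V) (k : ℕ) : ℕ :=
  Module.finrank (ZMod 2) (Homology X k)

/-- Boundaries are cycles. -/
theorem boundaries_le_cycles (X : PreAbstractSimplicialComplex V) (k : ℕ) :
    boundaries X k ≤ cycles X k := by
  cases k with
  | zero => exact le_top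
  | succ k =>
    rintro _ ⟨c, rfl⟩
    change boundary X k (boundary X (k + 1) c) = 0
    induction c using Finsupp.induction_linear with
    | zero => simp
    | add f g hf hg => rw [map_add, map_add, hf, hg, add_zero]
    | single s a =>
      have key : boundary X k (boundary X (k + 1) (Finsupp.single s 1)) = 0 := by
        simp only [boundary, Finsupp.linearCombination_single, one_smul, map_sum]
        rw [← Fintype.sum_sigma' (fun (v : {v // v ∈ s.1}) (w : {w // w ∈ (s.erase v).1}) =>
          (Finsupp.single ((s.erase v).erase w) 1 : Chain X k))]
        refine Finset.sum_involution (fun q _ => ⟨⟨q.2.1, Finset.mem_of_mem_erase q.2.2⟩,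
          ⟨q.1.1, Finset.mem_erase.2 ⟨(Finset.ne_of_mem_erase q.2.2).symm, q.1.2⟩⟩⟩)
          ?_ ?_ ?_ ?_
        · rintro ⟨v, w⟩ _
          have : ((s.erase v).erase w) = ((s.erase ⟨w.1, Finset.mem_of_mem_erase w.2⟩).erase
              ⟨v.1, Finset.mem_erase.2 ⟨(Finset.ne_of_mem_erase w.2).symm, v.2⟩⟩) :=
            Subtype.ext (Finset.erase_right_comm)
          rw [this, ← Finsupp.single_add]
          have h2 : (1 + 1 : ZMod 2) = 0 := by decide
          rw [h2, Finsupp.single_zero]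
        · rintro ⟨v, w⟩ _ _ h
          have := congrArg (fun q => q.1.1) h
          exact Finset.ne_of_mem_erase w.2 this
        · intros; exact Finset.mem_univ _
        · intros; rfl
      have hs : (Finsupp.single s a : Chain X (k + 1 + 1)) = a • Finsupp.single s 1 := by simp
      rw [hs, map_smul, map_smul, key, smul_zero]

end Homology

end QubitTDA

end

/-!
Everything is decided by the total correlations of pairs of qubits and by the invariance of the
purities `Tr ρ_J²` under local unitaries.

For a graph state the two-copy expression `⟨ψψ| F_J |ψψ⟩` of the purity of `ρ_J` is a sum of signs
which depends only on the edges between `J` and its complement (`czSign_swapOn`). Summing out the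
qubits outside `J` leaves `2 ^ (-|J|)` times the number of `a ⊆ J` for which every vertex outside
`J` has an even number of neighbours in `a` (`purity_graphVector`). For a pair `{i, j}` this shows
that `C₂({i, j}) ≤ 1/4` unless neither vertex is isolated and, away from the pair, `i` has no
neighbour, or `j` has none, or both have the same neighbours. A graph on at least two vertices all
of whose pairs are of this exceptional kind is a star or complete (`eq_starGraph_or_eq_top`), so
the bound `C₂ > 1/4` on all pairs forces a star or a complete graph
(`eq_starGraph_or_eq_top_of_totalCorrelation`). This bound holds if `β₀(1/4) = n`, because then the
complex has no edges at `ε = 1/4`; and it holds if the state is locally equivalent to the GHZ state,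
because then all pairs have `C₂ = 1/2`.

Conversely, the graph states of stars and complete graphs are obtained from the GHZ state by
explicit one-qubit unitaries: Hadamard gates on the leaves of a star
(`lUEquivalent_starGraph_ghz`), and for the complete graph the eigenbasis of the Pauli matrix `Y`,
as the sign `(-1) ^ (k choose 2)` is a combination of the characters `i ^ k` and `(-i) ^ k`
(`lUEquivalent_top_ghz`). By local unitary invariance, `C₂(J) = (|J| - 1) / 2` for nonempty proper
`J`, and `C₂(V) = n / 2` (`totalCorrelation_of_lUEquivalent_ghz`). Hence the complex consists of `n`
isolated points for `ε < 1/2` and is the one-dimensional complex of all pairs at `ε = 1/2`, whose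
Betti numbers follow from rank counting, the `0`-boundaries being the chains of augmentation `0`
(`boundaries_zero_eq_ker_augmentation`).
-/

noncomputable section

namespace QubitTDA

/-! ### Betti numbers in degrees `0` and `1` -/

section Homology

variable {V : Type*} {X : PreAbstractSimplicialComplex V}

/-- The vertex `v`, as a face. -/
def vertexFace (hX : ∀ v, {v} ∈ X.faces) (v : V) : Face X 0 :=
  ⟨{v}, hX v, by simp⟩

theorem vertexFace_bijective (hX : ∀ v, {v} ∈ X.faces) :
    Function.Bijective (vertexFace hX) := by
  refine ⟨fun v w h => Finset.singleton_injective (congrArg Subtype.val h), ?_⟩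
  rintro ⟨s, hs, hc⟩
  obtain ⟨v, rfl⟩ := Finset.card_eq_one.1 hc
  exact ⟨v, rfl⟩

theorem card_face_zero [Fintype V] (hX : ∀ v, {v} ∈ X.faces) :
    Nat.card (Face X 0) = Fintype.card V := by
  rw [← Nat.card_eq_of_bijective _ (vertexFace_bijective hX), Nat.card_eq_fintype_card]

variable [DecidableEq V]

theorem boundaries_eq_bot (X : PreAbstractSimplicialComplex V) (k : ℕ) [IsEmpty (Face X (k + 1))] :
    boundaries X k = ⊥ := by
  rw [boundaries, LinearMap.range_eq_bot]
  exact Subsingleton.elim _ _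

theorem boundary_single_pair (hX : ∀ v, {v} ∈ X.faces) {i j : V} (hij : i ≠ j)
    (h : {i, j} ∈ X.faces) :
    boundary X 0 (Finsupp.single ⟨{i, j}, h, Finset.card_pair hij⟩ 1) =
      Finsupp.single (vertexFace hX i) 1 + Finsupp.single (vertexFace hX j) 1 := by
  rw [boundary, Finsupp.linearCombination_single, one_smul]
  have hu : (Finset.univ : Finset {v // v ∈ ({i, j} : Finset V)}) =
      {⟨j, by simp⟩, ⟨i, by simp⟩} := by
    ext ⟨v, hv⟩
    simp only [Finset.mem_insert, Finset.mem_singleton] at hv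
    simp only [Finset.mem_univ, Finset.mem_insert, Finset.mem_singleton, Subtype.mk.injEq, true_iff]
    tauto
  have key : ∀ s : Face X 1, s.1 = {i, j} →
      (∑ v, Finsupp.single (s.erase v) 1 : Chain X 0) =
        Finsupp.single (vertexFace hX i) 1 + Finsupp.single (vertexFace hX j) 1 := by
    rintro ⟨s, hs, hc⟩ rfl
    rw [hu, Finset.sum_pair (by simpa using hij.symm)]
    congr 2 <;> refine Subtype.ext ?_
    · show ({i, j} : Finset V).erase j = {i}
      ext v; simp only [Finset.mem_erase, Finset.mem_insert, Finset.mem_singleton]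
      constructor
      · tauto
      · rintro rfl; simpa using hij
    · show ({i, j} : Finset V).erase i = {j}
      ext v; simp only [Finset.mem_erase, Finset.mem_insert, Finset.mem_singleton]
      constructor
      · tauto
      · rintro rfl; simpa using hij.symm
  exact key _ rfl

variable (X) in
/-- The sum of the coefficients of a `0`-chain. -/
def augmentation : Chain X 0 →ₗ[ZMod 2] ZMod 2 :=
  Finsupp.linearCombination (ZMod 2) fun _ => 1

/-- If every two vertices are joined by an edge, the `0`-boundaries are exactly the chains of
augmentation `0`. -/
theorem boundaries_zero_eq_ker_augmentation [Nonempty V] (hX : ∀ v, {v} ∈ X.faces)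
    (h : ∀ i j : V, i ≠ j → {i, j} ∈ X.faces) :
    boundaries X 0 = LinearMap.ker (augmentation X) := by
  have htwo : (1 + 1 : ZMod 2) = 0 := by decide
  refine le_antisymm ?_ ?_
  · rw [boundaries, LinearMap.range_le_ker_iff]
    refine Finsupp.lhom_ext' fun s => LinearMap.ext_ring ?_
    obtain ⟨s, hs, hc⟩ := s
    obtain ⟨i, j, hij, rfl⟩ := Finset.card_eq_two.1 hc
    simp only [LinearMap.comp_apply, Finsupp.lsingle_apply, LinearMap.zero_apply]
    rw [boundary_single_pair hX hij hs]
    simp [augmentation, htwo]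
  · obtain ⟨c⟩ := ‹Nonempty V›
    -- Modulo boundaries, every `0`-chain is its augmentation times the vertex `c`.
    have key : ∀ f : Chain X 0,
        f + augmentation X f • Finsupp.single (vertexFace hX c) 1 ∈ boundaries X 0 := by
      intro f
      induction f using Finsupp.induction_linear with
      | zero => simp
      | add f g hf hg =>
        have := add_mem hf hg
        rw [map_add, add_smul]
        convert this using 1
        abel
      | single s a =>
        obtain ⟨v, rfl⟩ := (vertexFace_bijective hX).2 s
        have hs : (Finsupp.single (vertexFace hX v) a : Chain X 0) =
            a • Finsupp.single (vertexFace hX v) 1 := by simp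
        have ha : augmentation X (Finsupp.single (vertexFace hX v) 1) = 1 := by
          simp [augmentation]
        rw [hs, map_smul, ha, smul_eq_mul, mul_one, ← smul_add]
        refine Submodule.smul_mem _ _ ?_
        by_cases hvc : v = c
        · rw [hvc, ← Finsupp.single_add, htwo, Finsupp.single_zero]
          exact zero_mem _
        · exact ⟨_, boundary_single_pair hX hvc (h v c hvc)⟩
    intro f hf
    have := key f
    rwa [LinearMap.mem_ker.1 hf, zero_smul, add_zero] at this

variable [Fintype V]

variable (X) in
theorem betti_add_finrank_boundaries (k : ℕ) :
    betti X k + Module.finrank (ZMod 2) (boundaries X k) =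
      Module.finrank (ZMod 2) (cycles X k) := by
  rw [← (Submodule.submoduleOfEquivOfLe (boundaries_le_cycles X k)).finrank_eq]
  exact Submodule.finrank_quotient_add_finrank _

variable (X) in
theorem betti_zero_add_finrank_boundaries :
    betti X 0 + Module.finrank (ZMod 2) (boundaries X 0) = Nat.card (Face X 0) := by
  have := Fintype.ofFinite (Face X 0)
  rw [betti_add_finrank_boundaries, cycles, finrank_top, Module.finrank_finsupp_self,
    Nat.card_eq_fintype_card]

variable (X) in
theorem finrank_boundaries_add_finrank_cycles (k : ℕ) :
    Module.finrank (ZMod 2) (boundaries X k) + Module.finrank (ZMod 2) (cycles X (k + 1)) =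
      Nat.card (Face X (k + 1)) := by
  have := Fintype.ofFinite (Face X (k + 1))
  have h := (boundary X k).finrank_range_add_finrank_ker
  rwa [Module.finrank_finsupp_self, ← Nat.card_eq_fintype_card] at h

/-- If there are as many components as vertices, there is no edge. -/
theorem pair_notMem_of_betti_zero (hX : ∀ v, {v} ∈ X.faces)
    (hb : betti X 0 = Fintype.card V) {i j : V} (hij : i ≠ j) : {i, j} ∉ X.faces := by
  intro h
  have h1 := betti_zero_add_finrank_boundaries X
  rw [card_face_zero hX, hb, Nat.add_eq_left, Submodule.finrank_eq_zero, boundaries,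
    LinearMap.range_eq_bot] at h1
  have h2 := boundary_single_pair hX hij h
  rw [h1, LinearMap.zero_apply] at h2
  have h3 := DFunLike.congr_fun h2 (vertexFace hX i)
  have h4 : vertexFace hX j ≠ vertexFace hX i :=
    (vertexFace_bijective hX).1.ne hij.symm
  simp [h4] at h3

theorem betti_zero_of_pair_notMem (hX : ∀ v, {v} ∈ X.faces)
    (h : ∀ i j : V, i ≠ j → {i, j} ∉ X.faces) : betti X 0 = Fintype.card V := by
  have : IsEmpty (Face X 1) := by
    constructor
    rintro ⟨s, hs, hc⟩
    obtain ⟨i, j, hij, rfl⟩ := Finset.card_eq_two.1 hc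
    exact h i j hij hs
  rw [← card_face_zero hX, ← betti_zero_add_finrank_boundaries, boundaries_eq_bot X 0,
    finrank_bot, add_zero]

theorem finrank_boundaries_zero_add_one [Nonempty V] (hX : ∀ v, {v} ∈ X.faces)
    (h : ∀ i j : V, i ≠ j → {i, j} ∈ X.faces) :
    Module.finrank (ZMod 2) (boundaries X 0) + 1 = Fintype.card V := by
  have := Fintype.ofFinite (Face X 0)
  have hr : LinearMap.range (augmentation X) = ⊤ := by
    rw [LinearMap.range_eq_top]
    intro a
    obtain ⟨c⟩ := ‹Nonempty V›
    exact ⟨Finsupp.single (vertexFace hX c) a, by simp [augmentation]⟩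
  have h1 := (augmentation X).finrank_range_add_finrank_ker
  rw [hr, finrank_top, Module.finrank_self, Module.finrank_finsupp_self,
    ← Nat.card_eq_fintype_card, card_face_zero hX] at h1
  rw [boundaries_zero_eq_ker_augmentation hX h]
  omega

theorem betti_zero_eq_one [Nonempty V] (hX : ∀ v, {v} ∈ X.faces)
    (h : ∀ i j : V, i ≠ j → {i, j} ∈ X.faces) : betti X 0 = 1 := by
  have h1 := betti_zero_add_finrank_boundaries X
  have h2 := finrank_boundaries_zero_add_one hX h
  rw [card_face_zero hX] at h1
  omega

/-- The first Betti number of the complete graph, as a one-dimensional complex. -/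
theorem betti_one_of_complete [Nonempty V] (hX : ∀ v, {v} ∈ X.faces)
    (h : ∀ i j : V, i ≠ j → {i, j} ∈ X.faces) (h3 : ∀ s : Finset V, s.card = 3 → s ∉ X.faces) :
    betti X 1 = (Fintype.card V - 1) * (Fintype.card V - 2) / 2 := by
  have : IsEmpty (Face X 2) := ⟨fun s => h3 s.1 s.2.2 s.2.1⟩
  have h1 := betti_add_finrank_boundaries X 1
  rw [boundaries_eq_bot X 1, finrank_bot, add_zero] at h1
  have h2 := finrank_boundaries_zero_add_one hX h
  have h4 : _ + Module.finrank (ZMod 2) (cycles X 1) = Nat.card (Face X 1) :=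
    finrank_boundaries_add_finrank_cycles X 0
  have h5 : Nat.card (Face X 1) = (Fintype.card V).choose 2 := by
    rw [← Finset.card_univ, ← Finset.card_powersetCard, ← Nat.card_eq_finsetCard]
    refine Nat.card_congr (Equiv.subtypeEquivRight fun s => ?_)
    rw [Finset.mem_powersetCard]
    refine ⟨fun hs => ⟨Finset.subset_univ _, hs.2⟩, fun hs => ⟨?_, hs.2⟩⟩
    obtain ⟨i, j, hij, rfl⟩ := Finset.card_eq_two.1 hs.2
    exact h i j hij
  rw [h5] at h4
  obtain ⟨m, hm⟩ : ∃ m, Fintype.card V = m + 1 := ⟨_, h2.symm⟩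
  have h6 : (m + 1).choose 2 = m + m.choose 2 := by
    rw [Nat.choose_succ_succ' m 1, Nat.choose_one_right]
  rw [hm] at h2 h4 ⊢
  rw [h6] at h4
  rw [h1, show m + 1 - 2 = m - 1 by omega, Nat.add_sub_cancel, ← Nat.choose_two_right]
  omega

end Homology

/-! ### Local unitaries, purities and the GHZ state -/

theorem invSqrtTwo_mul_self :
    ((1 / Real.sqrt 2 : ℝ) : ℂ) * ((1 / Real.sqrt 2 : ℝ) : ℂ) = 1 / 2 := by
  rw [← Complex.ofReal_mul, ← pow_two, div_pow, Real.sq_sqrt (by norm_num)]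
  norm_num

theorem star_invSqrtTwo : star ((1 / Real.sqrt 2 : ℝ) : ℂ) = ((1 / Real.sqrt 2 : ℝ) : ℂ) :=
  Complex.conj_ofReal _

section LocalUnitary

variable {V : Type*} [Fintype V]

theorem tensorOp_one : tensorOp (fun _ : V => (1 : Matrix (Fin 2) (Fin 2) ℂ)) = 1 := by
  ext x y
  simp only [tensorOp, Matrix.of_apply, Matrix.one_apply]
  rw [Finset.prod_ite_zero, Finset.prod_const_one]
  simp only [Finset.mem_univ, true_imp_iff, funext_iff]

theorem tensorOp_conjTranspose (A : V → Matrix (Fin 2) (Fin 2) ℂ) :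
    (tensorOp A)ᴴ = tensorOp (fun v => (A v)ᴴ) := by
  ext x y
  simp [tensorOp, Matrix.conjTranspose_apply]

variable [DecidableEq V]

theorem tensorOp_mul (A B : V → Matrix (Fin 2) (Fin 2) ℂ) :
    tensorOp A * tensorOp B = tensorOp (fun v => A v * B v) := by
  ext x y
  simp only [tensorOp, Matrix.mul_apply, Matrix.of_apply, ← Finset.prod_mul_distrib]
  rw [Finset.prod_univ_sum, Fintype.piFinset_univ]

/-- It suffices to prepare `ψ` from the GHZ vector by one-qubit unitaries. -/
theorem lUEquivalent_ghz_of_eq {ψ : (V → Fin 2) → ℂ} (W : V → Matrix (Fin 2) (Fin 2) ℂ)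
    (hW : ∀ v, (W v)ᴴ * W v = 1) (h : ψ = tensorOp W *ᵥ ghz V) : LUEquivalent ψ (ghz V) := by
  refine ⟨fun v => ⟨(W v)ᴴ, ?_⟩, ?_⟩
  · rw [Matrix.mem_unitaryGroup_iff, Matrix.star_eq_conjTranspose,
      Matrix.conjTranspose_conjTranspose, hW]
  · rw [h, Matrix.mulVec_mulVec, tensorOp_mul]
    simp only [hW, tensorOp_one, Matrix.one_mulVec]

theorem tensorOp_mulVec_ghz (W : V → Matrix (Fin 2) (Fin 2) ℂ) (x : V → Fin 2) :
    (tensorOp W *ᵥ ghz V) x =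
      ((1 / Real.sqrt 2 : ℝ) : ℂ) * (∏ v, W v (x v) 0 + ∏ v, W v (x v) 1) := by
  rw [ghz, Matrix.mulVec_smul, Matrix.mulVec_add, Matrix.mulVec_single_one,
    Matrix.mulVec_single_one]
  simp [tensorOp, Matrix.col_apply]

/-- `⟨ψψ| F_J |ψψ⟩` for a vector `ψ` which need not be normalized. -/
def purity (f : (V → Fin 2) → ℂ) (J : Finset V) : ℂ :=
  ∑ p : (V → Fin 2) × (V → Fin 2),
    f p.1 * f p.2 * star (f (swapOn J p).1 * f (swapOn J p).2)

theorem PureState.linearEntropy_eq (ψ : PureState V) (J : Finset V) :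
    ψ.linearEntropy J = 1 - (purity ψ.amp J).re := by
  rw [linearEntropy, trace_reduced_sq]
  rfl

open scoped Kronecker in
/-- Local unitaries do not change the purities, as `U ⊗ U` commutes with all swaps. -/
theorem purity_tensorOp_mulVec (U : V → Matrix.unitaryGroup (Fin 2) ℂ)
    (f : (V → Fin 2) → ℂ) (J : Finset V) :
    purity (tensorOp (fun v => (U v : Matrix (Fin 2) (Fin 2) ℂ)) *ᵥ f) J = purity f J := by
  set T := tensorOp (fun v => (U v : Matrix (Fin 2) (Fin 2) ℂ)) with hT
  let g : (V → Fin 2) × (V → Fin 2) → ℂ := fun p => f p.1 * f p.2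
  have hTT : Tᴴ * T = 1 := by
    rw [hT, tensorOp_conjTranspose, tensorOp_mul]
    simp only [← Matrix.star_eq_conjTranspose, Unitary.coe_star_mul_self, tensorOp_one]
  have hK : (T ⊗ₖ T)ᴴ * (T ⊗ₖ T) = 1 := by
    rw [Matrix.conjTranspose_kronecker, ← Matrix.mul_kronecker_mul, hTT,
      Matrix.one_kronecker_one]
  have happ : ∀ p q, (T ⊗ₖ T) p q = T p.1 q.1 * T p.2 q.2 := fun _ _ => rfl
  have hpair : ∀ p, (T *ᵥ f) p.1 * (T *ᵥ f) p.2 = ((T ⊗ₖ T) *ᵥ g) p := by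
    intro p
    simp only [Matrix.mulVec, dotProduct, Finset.sum_mul_sum, Fintype.sum_prod_type,
      happ, g]
    refine Finset.sum_congr rfl fun a _ => Finset.sum_congr rfl fun b _ => ?_
    ring
  have hcomm : ∀ p q, (T ⊗ₖ T) (swapOn J p) (swapOn J q) = (T ⊗ₖ T) p q := by
    intro p q
    rw [happ, happ]
    simp only [hT, tensorOp, Matrix.of_apply, ← Finset.prod_mul_distrib]
    refine Finset.prod_congr rfl fun v _ => ?_
    by_cases h : v ∈ J <;> simp [swapOn, h, mul_comm]
  have hswap : ∀ p, ((T ⊗ₖ T) *ᵥ g) (swapOn J p) = ((T ⊗ₖ T) *ᵥ (g ∘ swapOn J)) p := by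
    intro p
    simp only [Matrix.mulVec, dotProduct]
    rw [← Equiv.sum_comp (swapOn_involutive J).toPerm]
    simp only [Function.Involutive.coe_toPerm, hcomm, Function.comp_apply]
  have h1 : purity (T *ᵥ f) J = ((T ⊗ₖ T) *ᵥ g) ⬝ᵥ star ((T ⊗ₖ T) *ᵥ (g ∘ swapOn J)) := by
    simp only [purity, hpair, hswap, dotProduct, Pi.star_apply]
  rw [h1, dotProduct_comm, Matrix.star_mulVec, ← Matrix.dotProduct_mulVec, Matrix.mulVec_mulVec,
    hK, Matrix.one_mulVec, dotProduct_comm]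
  rfl

theorem purity_eq_of_lUEquivalent {f g : (V → Fin 2) → ℂ} (h : LUEquivalent f g)
    (J : Finset V) : purity g J = purity f J := by
  obtain ⟨U, rfl⟩ := h
  exact purity_tensorOp_mulVec U f J

theorem ghz_apply [Nonempty V] (x : V → Fin 2) :
    ghz V x = if x = (fun _ => 0) ∨ x = (fun _ => 1) then ((1 / Real.sqrt 2 : ℝ) : ℂ) else 0 := by
  obtain ⟨c⟩ := ‹Nonempty V›
  have h01 : (fun _ : V => (0 : Fin 2)) ≠ fun _ => 1 := fun h => by simpa using congrFun h c
  by_cases h0 : x = fun _ => 0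
  · subst h0; simp [ghz, h01]
  · by_cases h1 : x = fun _ => 1
    · subst h1; simp [ghz, h01.symm]
    · simp [ghz, h0, h1]

theorem sum_ghz_mul (F : (V → Fin 2) → ℂ) :
    ∑ x, ghz V x * F x = ((1 / Real.sqrt 2 : ℝ) : ℂ) * (F (fun _ => 0) + F (fun _ => 1)) := by
  simp only [ghz, Pi.smul_apply, Pi.add_apply, smul_eq_mul, mul_assoc, add_mul,
    ← Finset.mul_sum, Finset.sum_add_distrib, Pi.single_apply, ite_mul, one_mul, zero_mul,
    Finset.sum_ite_eq', Finset.mem_univ, if_true]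

/-- The reduced states of the GHZ state have purity `1/2`, except for the full one. -/
theorem purity_ghz {J : Finset V} (hJ : J.Nonempty) :
    purity (ghz V) J = if J = Finset.univ then 1 else 1 / 2 := by
  obtain ⟨a, ha⟩ := hJ
  have : Nonempty V := ⟨a⟩
  have hc : ∀ b : Fin 2, ghz V (fun _ => b) = ((1 / Real.sqrt 2 : ℝ) : ℂ) := by
    intro b; rw [ghz_apply]; fin_cases b <;> simp
  simp only [purity, Fintype.sum_prod_type, mul_assoc, ← Finset.mul_sum, sum_ghz_mul]
  by_cases hu : J = Finset.univ
  · simp only [hu, swapOn, Finset.mem_univ, if_true, hc, star_mul', star_invSqrtTwo]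
    linear_combination (4 * ((1 / Real.sqrt 2 : ℝ) : ℂ) * ((1 / Real.sqrt 2 : ℝ) : ℂ) + 2) *
      invSqrtTwo_mul_self
  · obtain ⟨b, hb⟩ : ∃ b, b ∉ J := by
      by_contra h
      push Not at h
      exact hu (Finset.eq_univ_iff_forall.2 h)
    have hmix : ∀ p q : Fin 2, p ≠ q → ghz V (fun v => if v ∈ J then p else q) = 0 := by
      intro p q hpq
      rw [ghz_apply, if_neg]
      rintro (h | h) <;>
      · have h1 := congrFun h a
        have h2 := congrFun h b
        simp only [ha, hb, if_true, if_false] at h1 h2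
        exact hpq (h1.trans h2.symm)
    simp only [hu, swapOn, if_false, ite_self, hc, star_mul', star_invSqrtTwo, hmix 0 1 (by decide),
      hmix 1 0 (by decide), star_zero, zero_mul, add_zero, zero_add]
    linear_combination (2 * ((1 / Real.sqrt 2 : ℝ) : ℂ) * ((1 / Real.sqrt 2 : ℝ) : ℂ) + 1) *
      invSqrtTwo_mul_self

theorem linearEntropy_of_lUEquivalent_ghz {ψ : PureState V} (h : LUEquivalent ψ.amp (ghz V))
    {J : Finset V} (hJ : J.Nonempty) :
    ψ.linearEntropy J = if J = Finset.univ then 0 else 1 / 2 := by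
  rw [ψ.linearEntropy_eq, ← purity_eq_of_lUEquivalent h, purity_ghz hJ]
  split_ifs <;> norm_num

theorem totalCorrelation_of_lUEquivalent_ghz {ψ : PureState V}
    (h : LUEquivalent ψ.amp (ghz V)) (hV : 1 < Fintype.card V) {J : Finset V}
    (hJ : J.Nonempty) :
    ψ.totalCorrelation J = J.card / 2 - if J = Finset.univ then 0 else 1 / 2 := by
  have h1 : ∀ j : V, ψ.linearEntropy {j} = 1 / 2 := fun j => by
    rw [linearEntropy_of_lUEquivalent_ghz h (Finset.singleton_nonempty j), if_neg]
    intro hj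
    have := congrArg Finset.card hj
    rw [Finset.card_singleton, Finset.card_univ] at this
    omega
  simp only [PureState.totalCorrelation, h1, linearEntropy_of_lUEquivalent_ghz h hJ,
    Finset.sum_const, nsmul_eq_mul]
  ring

end LocalUnitary

/-! ### Graphs in which every pair is a pendant edge or a pair of twins -/

section GraphClassification

variable {V : Type*} {G : SimpleGraph V}

/-- A graph without isolated vertices is a star or complete as soon as every pair of vertices
consists of a leaf and its neighbour or of two twins. If there is a leaf, the centre of the star
is its neighbour. -/
theorem eq_starGraph_or_eq_top (h0 : ∀ i, ∃ v, G.Adj i v)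
    (h : ∀ i j, i ≠ j → (∀ v, v ≠ i → v ≠ j → ¬ G.Adj i v) ∨ (∀ v, v ≠ i → v ≠ j → ¬ G.Adj j v) ∨
      (∀ v, v ≠ i → v ≠ j → (G.Adj i v ↔ G.Adj j v))) :
    (∃ c, G = SimpleGraph.starGraph c) ∨ G = ⊤ := by
  by_cases hl : ∃ i c, G.Adj i c ∧ ∀ v, v ≠ c → ¬ G.Adj i v
  · obtain ⟨i, c, hic, hi⟩ := hl
    have key : ∀ k, k ≠ c → G.Adj k c ∧ ∀ v, v ≠ c → ¬ G.Adj k v := by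
      intro k hkc
      by_cases hki : k = i
      · subst hki; exact ⟨hic, hi⟩
      rcases h i k (Ne.symm hki) with h1 | h1 | h1
      · exact absurd hic (h1 c hic.ne' hkc.symm)
      · obtain ⟨w, hw⟩ := h0 k
        by_cases hwi : w = i
        · subst hwi; exact absurd hw.symm (hi k hkc)
        · exact absurd hw (h1 w hwi hw.ne')
      · refine ⟨(h1 c hic.ne' hkc.symm).1 hic, fun v hvc hkv => ?_⟩
        by_cases hvi : v = i
        · subst hvi; exact hi k hkc hkv.symm
        · exact hi v hvc ((h1 v hvi hkv.ne').2 hkv)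
    refine Or.inl ⟨c, ?_⟩
    ext u v
    rw [SimpleGraph.starGraph_adj]
    constructor
    · intro huv
      refine ⟨huv.ne, ?_⟩
      by_contra hc
      push Not at hc
      exact (key u hc.1).2 v hc.2 huv
    · rintro ⟨huv, rfl | rfl⟩
      · exact (key v huv.symm).1.symm
      · exact (key u huv).1
  · push Not at hl
    have hα : ∀ i j, ¬ ∀ v, v ≠ i → v ≠ j → ¬ G.Adj i v := by
      intro i j hv
      obtain ⟨w, hw⟩ := h0 i
      have hwj : w = j := by
        by_contra hwj
        exact hv w hw.ne' hwj hw
      subst hwj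
      obtain ⟨v, hvw, hiv⟩ := hl i w hw
      exact hv v hiv.ne' hvw hiv
    have ht : ∀ i j, i ≠ j → ∀ v, v ≠ i → v ≠ j → (G.Adj i v ↔ G.Adj j v) := by
      intro i j hij
      rcases h i j hij with h1 | h1 | h1
      · exact absurd h1 (hα i j)
      · exact absurd (fun v hj hi => h1 v hi hj) (hα j i)
      · exact h1
    refine Or.inr ?_
    ext i j
    rw [SimpleGraph.top_adj]
    refine ⟨fun hij => hij.ne, fun hij => ?_⟩
    obtain ⟨k, hk⟩ := h0 i
    by_cases hkj : k = j
    · exact hkj ▸ hk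
    · have hjk := (ht i j hij k hk.ne' hkj).1 hk
      exact ((ht i k hk.ne j hij.symm (Ne.symm hkj)).2 hjk.symm)

end GraphClassification

/-! ### Purities of graph states -/

section GraphPurity

variable {V : Type*} [Fintype V] [DecidableEq V]

theorem czSign_mk (u v : V) (x : V → Fin 2) :
    czSign s(u, v) x = if x u = 1 ∧ x v = 1 then -1 else 1 := by
  simp [czSign]

theorem star_czSign (e : Sym2 V) (x : V → Fin 2) : star (czSign e x) = czSign e x := by
  unfold czSign; split <;> simp

/-- The sign of the pair `{u, v}` in `⟨ψψ| F_J |ψψ⟩` only depends on the sum of the two basis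
vectors, and is trivial unless `J` separates `u` and `v`. -/
theorem czSign_swapOn (J : Finset V) (u v : V) (x y : V → Fin 2) :
    czSign s(u, v) x * czSign s(u, v) y *
      (czSign s(u, v) (swapOn J (x, y)).1 * czSign s(u, v) (swapOn J (x, y)).2) =
      if (u ∈ J ↔ v ∈ J) then 1 else czSign s(u, v) (x + y) := by
  have h2 : ∀ a : Fin 2, a = 0 ∨ a = 1 := by decide
  simp only [czSign_mk, swapOn, Pi.add_apply]
  by_cases hu : u ∈ J <;> by_cases hv : v ∈ J <;> simp only [hu, hv, if_true, if_false] <;>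
    rcases h2 (x u) with h3 | h3 <;> rcases h2 (x v) with h4 | h4 <;>
    rcases h2 (y u) with h5 | h5 <;> rcases h2 (y v) with h6 | h6 <;> simp [h3, h4, h5, h6]

variable (G : SimpleGraph V) [DecidableRel G.Adj]

/-- A product over the edges, in which only those between `J` and its complement count. -/
theorem prod_edgeFinset_eq_prod_cut (J : Finset V) (F : Sym2 V → ℂ)
    (hF : ∀ u v, (u ∈ J ↔ v ∈ J) → F s(u, v) = 1) :
    ∏ e ∈ G.edgeFinset, F e =
      ∏ v : {v // v ∉ J}, ∏ u : {u // u ∈ J}, if G.Adj u v then F s(u.1, v.1) else 1 := by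
  rw [← Fintype.prod_prod_type', ← Finset.prod_filter]
  symm
  refine Finset.prod_of_injOn (fun p => s(p.2.1, p.1.1)) ?_ ?_ ?_ ?_
  · rintro ⟨⟨v, hv⟩, ⟨u, hu⟩⟩ _ ⟨⟨v', hv'⟩, ⟨u', hu'⟩⟩ _ h
    rcases Sym2.eq_iff.1 h with ⟨h1, h2⟩ | ⟨h1, h2⟩
    · simp only at h1 h2; subst h1 h2; rfl
    · simp only at h1 h2; subst h1 h2; exact absurd hu hv'
  · rintro p hp
    simpa using hp
  · intro e he hne
    induction e with | _ u v
    refine hF u v ?_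
    rw [SimpleGraph.mem_edgeFinset, SimpleGraph.mem_edgeSet] at he
    by_contra hJ
    by_cases hu : u ∈ J
    · have hv : v ∉ J := by tauto
      exact hne ⟨(⟨v, hv⟩, ⟨u, hu⟩), by simpa using he, rfl⟩
    · have hv : v ∈ J := by tauto
      exact hne ⟨(⟨u, hu⟩, ⟨v, hv⟩), by simpa using he.symm, Sym2.eq_swap⟩
  · intros; rfl

/-- The purity of `ρ_J` counts, up to `2 ^ |J|`, the sets `a` of qubits in `J` such that every
vertex outside `J` has an even number of neighbours in `a`: this is the rank of the adjacency
matrix between `J` and its complement in disguise. -/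
theorem purity_graphVector (J : Finset V) :
    purity (graphVector G) J = (1 / 2) ^ J.card * ∑ a : {u // u ∈ J} → Fin 2,
      ∏ v : {v // v ∉ J},
        (1 + ∏ u : {u // u ∈ J}, if G.Adj u v ∧ a u = 1 then (-1 : ℂ) else 1) / 2 := by
  let E := Equiv.piEquivPiSubtypeProd (· ∈ J) (fun _ : V => Fin 2)
  let F : (V → Fin 2) → ℂ := fun d =>
    ∏ v : {v // v ∉ J}, ∏ u : {u // u ∈ J}, if G.Adj u v then czSign s(u.1, v.1) d else 1
  have hterm : ∀ p : (V → Fin 2) × (V → Fin 2),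
      graphVector G p.1 * graphVector G p.2 *
        star (graphVector G (swapOn J p).1 * graphVector G (swapOn J p).2) =
      (1 / 2) ^ Fintype.card V * (1 / 2) ^ Fintype.card V * F (p.1 + p.2) := by
    rintro ⟨x, y⟩
    have hF : F (x + y) = ∏ e ∈ G.edgeFinset, (czSign e x * czSign e y *
        (czSign e (swapOn J (x, y)).1 * czSign e (swapOn J (x, y)).2)) := by
      rw [prod_edgeFinset_eq_prod_cut G J]
      · refine Finset.prod_congr rfl fun v _ => Finset.prod_congr rfl fun u _ => ?_
        rw [czSign_swapOn, if_neg (c := (u.1 ∈ J ↔ v.1 ∈ J)) (fun h => v.2 (h.1 u.2))]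
      · intro u v huv
        rw [czSign_swapOn, if_pos huv]
    simp only [hF, graphVector_apply, Finset.prod_mul_distrib, star_mul', star_prod, star_pow,
      star_czSign, star_invSqrtTwo]
    rw [← invSqrtTwo_mul_self, mul_pow]
    ring
  have hsum : ∑ p : (V → Fin 2) × (V → Fin 2), F (p.1 + p.2) = 2 ^ Fintype.card V * ∑ d, F d := by
    have hx : ∀ x : V → Fin 2, ∑ y, F (x + y) = ∑ d, F d :=
      fun x => Equiv.sum_comp (Equiv.addLeft x) F
    rw [Fintype.sum_prod_type]
    simp only [hx]
    simp
  have hFE : ∀ a z, F (E.symm (a, z)) = ∏ v : {v // v ∉ J},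
      if z v = 1 then ∏ u : {u // u ∈ J}, (if G.Adj u v ∧ a u = 1 then (-1 : ℂ) else 1)
        else 1 := by
    intro a z
    refine Finset.prod_congr rfl fun v _ => ?_
    have hv : E.symm (a, z) v.1 = z v := by simp [E, Equiv.piEquivPiSubtypeProd, v.2]
    have hu : ∀ u : {u // u ∈ J}, E.symm (a, z) u.1 = a u := fun u => by
      simp [E, Equiv.piEquivPiSubtypeProd, u.2]
    simp only [czSign_mk, hv, hu]
    by_cases h : z v = 1
    · simp only [h, and_true, if_true, ← ite_and]
    · simp [h]
  have hfact : ∀ t : {v // v ∉ J} → ℂ, ∑ z : {v // v ∉ J} → Fin 2,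
      ∏ v, (if z v = 1 then t v else 1) = ∏ v, (1 + t v) := by
    intro t
    have := Finset.prod_univ_sum (fun _ : {v // v ∉ J} => (Finset.univ : Finset (Fin 2)))
      (fun v b => if b = 1 then t v else 1)
    rw [Fintype.piFinset_univ] at this
    rw [← this]
    simp
  have hcard : Fintype.card {v // v ∉ J} + J.card = Fintype.card V := by
    rw [Fintype.card_subtype_compl, Fintype.card_coe]
    exact Nat.sub_add_cancel (Finset.card_le_univ J)
  rw [purity, Finset.sum_congr rfl fun p _ => hterm p, ← Finset.mul_sum, hsum,
    ← E.symm.sum_comp, Fintype.sum_prod_type]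
  simp only [hFE, hfact, Finset.prod_div_distrib, Finset.prod_const, Finset.card_univ,
    ← Finset.sum_div]
  rw [← hcard]
  simp only [pow_add, div_pow, one_pow]
  field_simp

/-- The functions on a pair of points. -/
def pairFunEquiv {i j : V} (hij : i ≠ j) (α : Type*) :
    ({v // v ∈ ({i, j} : Finset V)} → α) ≃ α × α where
  toFun a := (a ⟨i, by simp⟩, a ⟨j, by simp⟩)
  invFun p v := if v.1 = i then p.1 else p.2
  left_inv a := by
    ext ⟨v, hv⟩
    by_cases h : v = i
    · subst h; simp
    · have : v = j := by simpa [h] using hv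
      subst this; simp [h]
  right_inv p := by simp [hij.symm]

open Classical in
theorem prod_sign_div_two {ι : Type*} [Fintype ι] (p : ι → Prop) (t : ι → ℂ)
    (h1 : ∀ i, p i → t i = 1) (h2 : ∀ i, ¬ p i → t i = -1) :
    ∏ i, (1 + t i) / 2 = if ∀ i, p i then 1 else 0 := by
  have : ∀ i, (1 + t i) / 2 = if p i then 1 else 0 := by
    intro i
    by_cases hp : p i
    · simp only [h1 i hp, hp, if_true]; norm_num
    · simp only [h2 i hp, hp, if_false]; norm_num
  simp only [this, Finset.prod_ite_zero, Finset.prod_const_one, Finset.mem_univ, true_imp_iff]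

open Classical in
theorem purity_graphVector_singleton (i : V) :
    purity (graphVector G) {i} = (1 + if ∀ v, v ≠ i → ¬ G.Adj i v then 1 else 0) / 2 := by
  rw [purity_graphVector, ← (Equiv.funUnique {u // u ∈ ({i} : Finset V)} (Fin 2)).symm.sum_comp,
    Fin.sum_univ_two, prod_sign_div_two (fun _ => True), prod_sign_div_two
      (fun v : {v // v ∉ ({i} : Finset V)} => ¬ G.Adj i v)]
  · simp only [Subtype.forall, Finset.mem_singleton, Finset.card_singleton]
    simp only [implies_true, if_true]
    ring
  all_goals simp +contextual

open Classical in
theorem purity_graphVector_pair {i j : V} (hij : i ≠ j) :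
    purity (graphVector G) {i, j} =
      (1 + (if ∀ v, v ≠ i → v ≠ j → ¬ G.Adj i v then 1 else 0) +
        (if ∀ v, v ≠ i → v ≠ j → ¬ G.Adj j v then 1 else 0) +
        (if ∀ v, v ≠ i → v ≠ j → (G.Adj i v ↔ G.Adj j v) then 1 else 0)) / 4 := by
  have hu : (Finset.univ : Finset {v // v ∈ ({i, j} : Finset V)}) =
      {⟨i, by simp⟩, ⟨j, by simp⟩} := by
    ext ⟨v, hv⟩
    simp only [Finset.mem_insert, Finset.mem_singleton] at hv
    simp only [Finset.mem_univ, Finset.mem_insert, Finset.mem_singleton, Subtype.mk.injEq, true_iff]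
    exact hv
  have hp : ∀ (p : Fin 2 × Fin 2) (v : V), (∏ u : {u // u ∈ ({i, j} : Finset V)},
      if G.Adj u v ∧ (pairFunEquiv hij (Fin 2)).symm p u = 1 then (-1 : ℂ) else 1) =
      (if G.Adj i v ∧ p.1 = 1 then -1 else 1) * (if G.Adj j v ∧ p.2 = 1 then -1 else 1) := by
    intro p v
    rw [hu, Finset.prod_pair (by simpa using hij)]
    simp [pairFunEquiv, hij.symm]
  have hf : ∀ (p : Fin 2 × Fin 2) (P : V → Prop),
      (∀ v, P v ↔ ((G.Adj i v ∧ p.1 = 1) ↔ (G.Adj j v ∧ p.2 = 1))) →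
      ∏ v : {v // v ∉ ({i, j} : Finset V)}, (1 + ∏ u : {u // u ∈ ({i, j} : Finset V)},
        if G.Adj u v ∧ (pairFunEquiv hij (Fin 2)).symm p u = 1 then (-1 : ℂ) else 1) / 2 =
        if ∀ v, v ≠ i → v ≠ j → P v then 1 else 0 := by
    intro p P hP
    simp only [hp]
    rw [prod_sign_div_two (fun v : {v // v ∉ ({i, j} : Finset V)} => P v)]
    · simp only [Subtype.forall, Finset.mem_insert, Finset.mem_singleton, not_or, and_imp]
    all_goals
      intro v hv
      rw [hP] at hv
      by_cases h1 : G.Adj i v ∧ p.1 = 1 <;> by_cases h2 : G.Adj j v ∧ p.2 = 1 <;>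
        simp only [h1, h2, and_self, not_true_eq_false, if_true, if_false, iff_true, true_iff,
          not_false_eq_true] at hv ⊢ <;> norm_num
  rw [purity_graphVector, ← (pairFunEquiv hij (Fin 2)).symm.sum_comp, Finset.card_pair hij,
    Fintype.sum_prod_type, Fin.sum_univ_two, Fin.sum_univ_two, Fin.sum_univ_two,
    hf (0, 0) (fun _ => True) (by simp), hf (0, 1) (fun v => ¬ G.Adj j v) (by simp),
    hf (1, 0) (fun v => ¬ G.Adj i v) (by simp),
    hf (1, 1) (fun v => (G.Adj i v ↔ G.Adj j v)) (by simp)]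
  simp only [implies_true, if_true]
  ring_nf

/-- If a vertex of the pair `{i, j}` is isolated, then `C₂({i, j}) = 0`; if neither is, then
`C₂({i, j}) = (1 + m) / 4`, where `m` counts which of the three conditions in
`eq_starGraph_or_eq_top` hold for the pair. -/
theorem eq_starGraph_or_eq_top_of_totalCorrelation (hV : 1 < Fintype.card V)
    (h : ∀ i j, i ≠ j → 1 / 4 < (graphState G).totalCorrelation {i, j}) :
    (∃ c, G = SimpleGraph.starGraph c) ∨ G = ⊤ := by
  classical
  have hC : ∀ i j, i ≠ j → (∃ v, G.Adj i v) ∧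
      ((∀ v, v ≠ i → v ≠ j → ¬ G.Adj i v) ∨ (∀ v, v ≠ i → v ≠ j → ¬ G.Adj j v) ∨
      (∀ v, v ≠ i → v ≠ j → (G.Adj i v ↔ G.Adj j v))) := by
    intro i j hij
    have h1 := h i j hij
    have hamp : (graphState G).amp = graphVector G := rfl
    rw [PureState.totalCorrelation, Finset.sum_pair hij] at h1
    simp only [PureState.linearEntropy_eq, hamp, purity_graphVector_singleton,
      purity_graphVector_pair G hij] at h1
    refine ⟨?_, ?_⟩
    · by_contra h2
      push Not at h2
      have h3 : (∀ v, v ≠ j → ¬ G.Adj j v) ↔ (∀ v, v ≠ i → v ≠ j → ¬ G.Adj j v) := by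
        refine ⟨fun h v _ => h v, fun h v hv hjv => ?_⟩
        by_cases hvi : v = i
        · subst hvi; exact h2 _ hjv.symm
        · exact h v hvi hv hjv
      simp only [h2, h3, not_false_eq_true, implies_true, if_true, false_iff] at h1
      split_ifs at h1 <;> norm_num at h1
    · by_contra h2
      rw [not_or, not_or] at h2
      simp only [h2.1, h2.2.1, h2.2.2, if_false] at h1
      split_ifs at h1 <;> norm_num at h1
  have hex : ∀ i : V, ∃ j, i ≠ j := fun i =>
    have := Fintype.one_lt_card_iff_nontrivial.1 hV
    (exists_ne i).imp fun _ => Ne.symm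
  exact eq_starGraph_or_eq_top (fun i => (hex i).elim fun j hj => (hC i j hj).1)
    fun i j hij => (hC i j hij).2

end GraphPurity

/-! ### Stars and complete graphs give the GHZ state -/

section Preparation

variable {V : Type*} [Fintype V] [DecidableEq V]

theorem hadamard_apply (y b : Fin 2) :
    hadamard y b = ((1 / Real.sqrt 2 : ℝ) : ℂ) * if b = 1 ∧ y = 1 then -1 else 1 := by
  fin_cases y <;> fin_cases b <;> simp [hadamard]

theorem hadamard_conjTranspose_mul_self : hadamardᴴ * hadamard = 1 := by
  rw [hadamard, Matrix.conjTranspose_smul, star_invSqrtTwo, Matrix.smul_mul, Matrix.mul_smul,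
    smul_smul, invSqrtTwo_mul_self]
  ext i j
  fin_cases i <;> fin_cases j <;> simp [Matrix.mul_apply, Fin.sum_univ_two] <;> norm_num

theorem prod_edgeFinset_starGraph (c : V) [DecidableRel (SimpleGraph.starGraph c).Adj]
    (F : Sym2 V → ℂ) :
    ∏ e ∈ (SimpleGraph.starGraph c).edgeFinset, F e = ∏ v ∈ Finset.univ.erase c, F s(c, v) := by
  symm
  refine Finset.prod_of_injOn (fun v => s(c, v)) ?_ ?_ ?_ ?_
  · intro v _ w _ h
    exact Sym2.congr_right.1 h
  · intro v hv
    simpa [eq_comm] using hv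
  · intro e he hne
    refine absurd ?_ hne
    induction e with | _ u v
    rw [SimpleGraph.mem_edgeFinset, SimpleGraph.mem_edgeSet, SimpleGraph.starGraph_adj] at he
    obtain ⟨huv, rfl | rfl⟩ := he
    · exact ⟨v, by simpa using huv.symm, rfl⟩
    · exact ⟨u, by simpa using huv, Sym2.eq_swap⟩
  · intros; rfl

/-- Hadamard gates on the leaves turn the GHZ vector into the graph state of a star. -/
theorem lUEquivalent_starGraph_ghz (c : V) [DecidableRel (SimpleGraph.starGraph c).Adj] :
    LUEquivalent (graphVector (SimpleGraph.starGraph c)) (ghz V) := by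
  refine lUEquivalent_ghz_of_eq (fun v => if v = c then 1 else hadamard) ?_ ?_
  · intro v
    by_cases h : v = c
    · simp [h]
    · simp [h, hadamard_conjTranspose_mul_self]
  ext x
  have hW : ∀ b : Fin 2, ∏ v, (if v = c then (1 : Matrix (Fin 2) (Fin 2) ℂ) else hadamard) (x v) b =
      (if x c = b then 1 else 0) * (((1 / Real.sqrt 2 : ℝ) : ℂ) ^ (Fintype.card V - 1) *
        ∏ v ∈ Finset.univ.erase c, if b = 1 ∧ x v = 1 then -1 else 1) := by
    intro b
    rw [← Finset.mul_prod_erase _ _ (Finset.mem_univ c)]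
    congr 1
    · simp [Matrix.one_apply]
    · have : ∀ v ∈ Finset.univ.erase c,
          (if v = c then (1 : Matrix (Fin 2) (Fin 2) ℂ) else hadamard) (x v) b =
            ((1 / Real.sqrt 2 : ℝ) : ℂ) * if b = 1 ∧ x v = 1 then -1 else 1 := by
        intro v hv
        rw [if_neg (Finset.ne_of_mem_erase hv), hadamard_apply]
      rw [Finset.prod_congr rfl this, Finset.prod_mul_distrib, Finset.prod_const,
        Finset.card_erase_of_mem (Finset.mem_univ c), Finset.card_univ]
  obtain ⟨m, hm⟩ : ∃ m, Fintype.card V = m + 1 :=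
    Nat.exists_eq_succ_of_ne_zero (Fintype.card_pos_iff.2 ⟨c⟩).ne'
  rw [tensorOp_mulVec_ghz, hW, hW, graphVector_apply, prod_edgeFinset_starGraph]
  simp only [czSign_mk, hm, Nat.add_sub_cancel, pow_succ]
  generalize hxc : x c = y
  fin_cases y <;> simp <;> ring

theorem prod_czSign_top [DecidableRel (⊤ : SimpleGraph V).Adj] (x : V → Fin 2) :
    ∏ e ∈ (⊤ : SimpleGraph V).edgeFinset, czSign e x =
      (-1) ^ ({v | x v = 1} : Finset V).card.choose 2 := by
  classical
  rw [← Sym2.card_image_offDiag, ← Finset.prod_const]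
  simp only [czSign]
  rw [← Finset.prod_filter]
  refine Finset.prod_congr ?_ fun _ _ => rfl
  ext e
  induction e with | _ u v
  simp only [Finset.mem_filter, SimpleGraph.mem_edgeFinset, SimpleGraph.mem_edgeSet,
    SimpleGraph.top_adj, Sym2.mem_iff, forall_eq_or_imp, forall_eq, Finset.mem_image,
    Finset.mem_offDiag, Prod.exists, Finset.mem_univ, true_and]
  constructor
  · rintro ⟨huv, hu, hv⟩
    exact ⟨u, v, ⟨hu, hv, huv⟩, rfl⟩
  · rintro ⟨a, b, ⟨ha, hb, hab⟩, h⟩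
    rcases Sym2.eq_iff.1 h with ⟨rfl, rfl⟩ | ⟨rfl, rfl⟩
    · exact ⟨hab, ha, hb⟩
    · exact ⟨hab.symm, hb, ha⟩

/-- The quadratic sign `(-1) ^ (k choose 2)` is a combination of two characters. -/
theorem I_pow_add_neg_I_pow (k : ℕ) :
    (1 - Complex.I) * Complex.I ^ k + (1 + Complex.I) * (-Complex.I) ^ k =
      2 * (-1) ^ k.choose 2 := by
  induction k using Nat.twoStepInduction with
  | zero => norm_num
  | one =>
    simp only [pow_one, Nat.choose_succ_self, pow_zero]
    linear_combination (-2) * Complex.I_mul_I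
  | more k ih _ =>
    have h : (k + 2).choose 2 = k.choose 2 + (2 * k + 1) := by
      rw [Nat.choose_succ_succ' (k + 1) 1, Nat.choose_succ_succ' k 1, Nat.choose_one_right,
        Nat.choose_one_right]
      ring
    rw [h, pow_add (-1 : ℂ), pow_succ (-1 : ℂ) (2 * k), pow_mul, neg_one_sq, one_pow,
      pow_add Complex.I, pow_add (-Complex.I), neg_sq, Complex.I_sq]
    linear_combination -ih

/-- The unitary with columns `(|0⟩ ± i|1⟩)/√2`, the eigenvectors of the Pauli matrix `Y`. -/
def yBasis : Matrix (Fin 2) (Fin 2) ℂ :=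
  ((1 / Real.sqrt 2 : ℝ) : ℂ) • !![1, 1; Complex.I, -Complex.I]

/-- The phase gate with entries `e^{∓iπ/4}`. -/
def phaseGate : Matrix (Fin 2) (Fin 2) ℂ :=
  ((1 / Real.sqrt 2 : ℝ) : ℂ) • !![1 - Complex.I, 0; 0, 1 + Complex.I]

theorem yBasis_conjTranspose_mul_self : yBasisᴴ * yBasis = 1 := by
  rw [yBasis, Matrix.conjTranspose_smul, star_invSqrtTwo, Matrix.smul_mul, Matrix.mul_smul,
    smul_smul, invSqrtTwo_mul_self]
  ext i j
  fin_cases i <;> fin_cases j <;> simp [Matrix.mul_apply, Fin.sum_univ_two] <;> norm_num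

theorem phaseGate_conjTranspose_mul_self : phaseGateᴴ * phaseGate = 1 := by
  rw [phaseGate, Matrix.conjTranspose_smul, star_invSqrtTwo, Matrix.smul_mul, Matrix.mul_smul,
    smul_smul, invSqrtTwo_mul_self]
  ext i j
  fin_cases i <;> fin_cases j <;> simp [Matrix.mul_apply, Fin.sum_univ_two]
  · linear_combination (-1 / 2) * Complex.I_mul_I
  · linear_combination (-1 / 2) * Complex.I_mul_I

/-- The graph state of the complete graph is a superposition of the two product vectors
`⨂ (|0⟩ ± i|1⟩)/√2`, with the phases `e^{∓iπ/4}` which one of the qubits can absorb. -/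
theorem lUEquivalent_top_ghz [Nonempty V] [DecidableRel (⊤ : SimpleGraph V).Adj] :
    LUEquivalent (graphVector (⊤ : SimpleGraph V)) (ghz V) := by
  obtain ⟨c⟩ := ‹Nonempty V›
  refine lUEquivalent_ghz_of_eq (fun v => yBasis * if v = c then phaseGate else 1) ?_ ?_
  · intro v
    rw [Matrix.conjTranspose_mul, Matrix.mul_assoc, ← Matrix.mul_assoc _ yBasis,
      yBasis_conjTranspose_mul_self, Matrix.one_mul]
    by_cases h : v = c
    · simp [h, phaseGate_conjTranspose_mul_self]
    · simp [h]
  ext x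
  have h0 : ∀ v, (yBasis * if v = c then phaseGate else 1) (x v) 0 =
      ((1 / Real.sqrt 2 : ℝ) : ℂ) * ((if x v = 1 then Complex.I else 1) *
        if v = c then ((1 / Real.sqrt 2 : ℝ) : ℂ) * (1 - Complex.I) else 1) := by
    intro v
    generalize x v = y
    by_cases h : v = c <;> fin_cases y <;>
      simp [h, yBasis, phaseGate, Matrix.mul_apply, Fin.sum_univ_two] <;> ring
  have h1 : ∀ v, (yBasis * if v = c then phaseGate else 1) (x v) 1 =
      ((1 / Real.sqrt 2 : ℝ) : ℂ) * ((if x v = 1 then -Complex.I else 1) *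
        if v = c then ((1 / Real.sqrt 2 : ℝ) : ℂ) * (1 + Complex.I) else 1) := by
    intro v
    generalize x v = y
    by_cases h : v = c <;> fin_cases y <;>
      simp [h, yBasis, phaseGate, Matrix.mul_apply, Fin.sum_univ_two] <;> ring
  rw [tensorOp_mulVec_ghz, graphVector_apply, prod_czSign_top]
  simp only [h0, h1, Finset.prod_mul_distrib, Finset.prod_ite_eq', Finset.mem_univ, if_true,
    ← Finset.prod_filter, Finset.prod_const, Finset.card_univ]
  have hk := I_pow_add_neg_I_pow ({v | x v = 1} : Finset V).card
  linear_combination (-((1 / Real.sqrt 2 : ℝ) : ℂ) ^ Fintype.card V *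
    ((1 / Real.sqrt 2 : ℝ) : ℂ) * ((1 / Real.sqrt 2 : ℝ) : ℂ)) * hk -
    2 * ((1 / Real.sqrt 2 : ℝ) : ℂ) ^ Fintype.card V *
      (-1) ^ ({v | x v = 1} : Finset V).card.choose 2 * invSqrtTwo_mul_self

theorem lUEquivalent_ghz_of_star_or_top [Nonempty V] (G : SimpleGraph V) [DecidableRel G.Adj]
    (h : (∃ c : V, G = SimpleGraph.starGraph c) ∨ G = ⊤) :
    LUEquivalent (graphState G).amp (ghz V) := by
  rcases h with ⟨c, rfl⟩ | rfl
  · exact lUEquivalent_starGraph_ghz c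
  · exact lUEquivalent_top_ghz

end Preparation

/-! ### The entanglement complex -/

section Complexes

variable {V : Type*} [Fintype V] [DecidableEq V]

theorem PureState.singleton_mem_faces (ψ : PureState V) {ε : ℝ} (hε : 0 ≤ ε) (v : V) :
    {v} ∈ (ψ.complex ε).faces :=
  ⟨Finset.singleton_nonempty v, by simpa [PureState.totalCorrelation] using hε⟩

end Complexes

end QubitTDA

end

theorem mainTheorem2 {V : Type*} [Fintype V] [DecidableEq V]
    (n : ℕ) (hcard : Fintype.card V = n) (hn : 3 ≤ n)
    (G : SimpleGraph V) [DecidableRel G.Adj] :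
    (((∀ ε : ℝ, 0 ≤ ε → ε < 1 / 2 →
          QubitTDA.betti ((QubitTDA.graphState G).complex ε) 0 = n) ∧
        QubitTDA.betti ((QubitTDA.graphState G).complex (1 / 2)) 0 = 1 ∧
        QubitTDA.betti ((QubitTDA.graphState G).complex (1 / 2)) 1 = (n - 1) * (n - 2) / 2) ↔
      ((∃ c : V, G = SimpleGraph.starGraph c) ∨ G = ⊤)) ∧
    (((∃ c : V, G = SimpleGraph.starGraph c) ∨ G = ⊤) ↔
      QubitTDA.LUEquivalent (QubitTDA.graphState G).amp (QubitTDA.ghz V)) := by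
  subst hcard
  have hV : 1 < Fintype.card V := by omega
  have : Nonempty V := Fintype.card_pos_iff.1 (by omega)
  have hpair_ne : ∀ i j : V, ({i, j} : Finset V) ≠ Finset.univ := fun i j h => by
    have h1 := Finset.card_le_two (a := i) (b := j)
    rw [h, Finset.card_univ] at h1
    omega
  have hpair : QubitTDA.LUEquivalent (QubitTDA.graphState G).amp (QubitTDA.ghz V) →
      ∀ i j : V, i ≠ j → (QubitTDA.graphState G).totalCorrelation {i, j} = 1 / 2 := by
    intro hLU i j hij
    rw [QubitTDA.totalCorrelation_of_lUEquivalent_ghz hLU hV (by simp), if_neg (hpair_ne i j),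
      Finset.card_pair hij]
    norm_num
  refine ⟨⟨fun h => ?_, fun h => ?_⟩, fun h => ?_, fun h => ?_⟩
  · -- At `ε = 1/4` there is no edge, so every pair has total correlation above `1/4`.
    refine QubitTDA.eq_starGraph_or_eq_top_of_totalCorrelation G hV fun i j hij => ?_
    by_contra hle
    exact QubitTDA.pair_notMem_of_betti_zero
      ((QubitTDA.graphState G).singleton_mem_faces (by norm_num))
      (h.1 (1 / 4) (by norm_num) (by norm_num)) hij ⟨by simp, not_lt.1 hle⟩
  · have hLU := QubitTDA.lUEquivalent_ghz_of_star_or_top G h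
    have hX := (QubitTDA.graphState G).singleton_mem_faces (ε := 1 / 2) (by norm_num)
    have hedge : ∀ i j : V, i ≠ j → {i, j} ∈ ((QubitTDA.graphState G).complex (1 / 2)).faces :=
      fun i j hij => ⟨by simp, (hpair hLU i j hij).le⟩
    refine ⟨fun ε h0 h1 => ?_, QubitTDA.betti_zero_eq_one hX hedge,
      QubitTDA.betti_one_of_complete hX hedge ?_⟩
    · refine QubitTDA.betti_zero_of_pair_notMem
        ((QubitTDA.graphState G).singleton_mem_faces h0) fun i j hij hmem => ?_
      have h2 : (QubitTDA.graphState G).totalCorrelation {i, j} ≤ ε := hmem.2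
      rw [hpair hLU i j hij] at h2
      linarith
    · intro s hs hmem
      have h2 : (QubitTDA.graphState G).totalCorrelation s ≤ 1 / 2 := hmem.2
      rw [QubitTDA.totalCorrelation_of_lUEquivalent_ghz hLU hV hmem.1, hs] at h2
      split_ifs at h2 <;> norm_num at h2
  · exact QubitTDA.lUEquivalent_ghz_of_star_or_top G h
  · refine QubitTDA.eq_starGraph_or_eq_top_of_totalCorrelation G hV fun i j hij => ?_
    rw [hpair h i j hij]
    norm_num
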